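/- Let \(R\) be a commutative ring, \(H\) a Hopf algebra over \(R\) which is flat as an \(R\)-module, and \(A\) a right \(H\)-comodule algebra with coaction \(b\mapsto b_{(0)}\otimes b_{(1)}\in A\otimes_R H\). Put \(B=A^{co\,H}=\{a\in A: a_{(0)}\otimes a_{(1)}=a\otimes 1\}\). Assume that \(A/B\) is an \(H\)-crossed product, i.e. \(A\cong B\#_\sigma H\) as \(H\)-comodule algebras for some measuring of \(B\) by \(H\) and some normalised convolution invertible cocycle \(\sigma:H\otimes_R H\to B\) that makes \(B\) a twisted \(H\)-module, and that \(B\) is a faithfully flat Mittag--Leffler \(R\)-module. A generalised quotient of \(H\) is a quotient \(\pi_Q:H\to Q=H/I\) by a right ideal coideal \(I\); these form a complete lattice, where \(H/I\le H/J\) iff \(J\subseteq I\). Put \(A^{co\,Q}=\{a\in A: a_{(0)}\otimes\pi_Q(a_{(1)})=a\otimes\pi_Q(1)\}\). For a subalgebra \(S\) of \(A\) put \(\psi(S)=\bigvee\{Q: S\subseteq A^{co\,Q}\}\), and call \(S\) closed if \(S=A^{co\,\psi(S)}\). Let \(A\square_Q H\) be the set of all \(x\in A\otimes_R H\) at which the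 two maps \(A\otimes_R H\to A\otimes_R Q\otimes_R H\) induced by \(a\mapsto a_{(0)}\otimes\pi_Q(a_{(1)})\) and \(h\mapsto \pi_Q(h_{(1)})\otimes h_{(2)}\) agree. Theorem. Let \(S\) be a subalgebra with \(B\subseteq S\subseteq A\). Then \(S\) is closed if and only if the canonical map \[\mathit{can}_S: S\otimes_B A\to A\otimes_R H,\qquad a\otimes b\mapsto ab_{(0)}\otimes b_{(1)},\] is an isomorphism onto \(A\square_{\psi(S)}H\), i.e. is injective with image \(A\square_{\psi(S)}H\). -/

import Mathlib

open scoped TensorProduct Coalgebra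

universe u v w w'

namespace HopfGalois

/-- A module `M` over `R` is Mittag-Leffler if for every family `(N i)` of `R`-modules the
canonical map `M ⊗ (∏ N i) → ∏ (M ⊗ N i)` is injective.  It is enough to test families that live
in the universe of `R` (the general case reduces to families, indexed by submodules of the `R ^ n`,
of finitely generated modules). -/
def IsMittagLeffler (R : Type u) (M : Type v) [CommRing R] [AddCommGroup M] [Module R M] : Prop :=
  ∀ (ι : Type u) (N : ι → Type u) [∀ i, AddCommGroup (N i)] [∀ i, Module R (N i)],
    Function.Injective (TensorProduct.piRightHom R R M N)

/-- A right `H`-comodule algebra: an `R`-algebra `A` with a coassociative and counital coaction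
`δ : A → A ⊗ H` which is an algebra homomorphism. -/
class ComoduleAlgebra (R : Type u) (H : Type v) (A : Type w) [CommRing R] [Ring H]
    [HopfAlgebra R H] [Ring A] [Algebra R A] where
  /-- the coaction `a ↦ a₍₀₎ ⊗ a₍₁₎` -/
  coact : A →ₐ[R] A ⊗[R] H
  coassoc : ∀ a : A,
    TensorProduct.assoc R A H H (coact.toLinearMap.rTensor H (coact a)) =
      (Coalgebra.comul (R := R) (A := H)).lTensor A (coact a)
  counit : ∀ a : A,
    TensorProduct.rid R A ((Coalgebra.counit (R := R) (A := H)).lTensor A (coact a)) = a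

/-- A generalised quotient `Q = H / ker` of `H`: a quotient by a right ideal coideal. -/
@[ext]
structure GenQuot (R : Type u) (H : Type v) [CommRing R] [Ring H] [HopfAlgebra R H] where
  /-- the right ideal coideal `I` with `Q = H / I` -/
  ker : Submodule R H
  isCoideal : ker.IsCoideal
  mul_mem : ∀ x ∈ ker, ∀ h : H, x * h ∈ ker

namespace GenQuot

variable {R : Type u} {H : Type v} [CommRing R] [Ring H] [HopfAlgebra R H]

/-- The underlying `R`-module `H / I` of a generalised quotient. -/
abbrev Carrier (Q : GenQuot R H) : Type v := H ⧸ Q.ker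

/-- The projection `π_Q : H → Q`. -/
abbrev proj (Q : GenQuot R H) : H →ₗ[R] Q.Carrier := Q.ker.mkQ

/-- `Q₁ ≤ Q₂` if and only if `Q₁` is a quotient of `Q₂`. -/
instance : PartialOrder (GenQuot R H) where
  le Q₁ Q₂ := Q₂.ker ≤ Q₁.ker
  le_refl _ := le_rfl
  le_trans _ _ _ h₁ h₂ := le_trans h₂ h₁
  le_antisymm _ _ h₁ h₂ := GenQuot.ext (le_antisymm h₂ h₁)

theorem le_def (Q₁ Q₂ : GenQuot R H) : Q₁ ≤ Q₂ ↔ Q₂.ker ≤ Q₁.ker := Iff.rfl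

/-- The infimum of a set of generalised quotients is the quotient by the sum of the kernels. -/
instance : InfSet (GenQuot R H) where
  sInf s :=
    { ker := ⨆ Q ∈ s, Q.ker
      isCoideal := by
        rw [Submodule.isCoideal_iff_comul_mem]
        have key : ∀ Q ∈ s, Q.ker ≤ ⨆ Q ∈ s, Q.ker := fun Q hQ => le_iSup₂_of_le Q hQ le_rfl
        constructor
        · have h : (⨆ Q ∈ s, Q.ker) ≤ LinearMap.ker (Coalgebra.counit (R := R) (A := H)) :=
            iSup₂_le fun Q _ x hx => Q.isCoideal.counit_eq_zero hx
          exact fun x hx => h hx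
        · have h : (⨆ Q ∈ s, Q.ker) ≤
              (LinearMap.range ((⨆ Q ∈ s, Q.ker).subtype.lTensor H) ⊔
                LinearMap.range ((⨆ Q ∈ s, Q.ker).subtype.rTensor H)).comap
                  (Coalgebra.comul (R := R) (A := H)) := by
            refine iSup₂_le fun Q hQ x hx => ?_
            have h₁ := ((Submodule.isCoideal_iff_comul_mem Q.ker).1 Q.isCoideal).2 x hx
            refine (sup_le_sup ?_ ?_ :
              LinearMap.range (Q.ker.subtype.lTensor H) ⊔
                LinearMap.range (Q.ker.subtype.rTensor H) ≤ _) h₁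
            · rintro _ ⟨y, rfl⟩
              refine ⟨(Submodule.inclusion (key Q hQ)).lTensor H y, ?_⟩
              rw [← LinearMap.comp_apply, ← LinearMap.lTensor_comp]
              rfl
            · rintro _ ⟨y, rfl⟩
              refine ⟨(Submodule.inclusion (key Q hQ)).rTensor H y, ?_⟩
              rw [← LinearMap.comp_apply, ← LinearMap.rTensor_comp]
              rfl
          exact fun x hx => h hx
      mul_mem := by
        intro x hx h
        have hle : (⨆ Q ∈ s, Q.ker) ≤
            (⨆ Q ∈ s, Q.ker).comap (LinearMap.mulRight R h) :=
          iSup₂_le fun Q hQ y hy =>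
            (le_iSup₂_of_le Q hQ le_rfl : Q.ker ≤ ⨆ Q ∈ s, Q.ker) (Q.mul_mem y hy h)
        exact hle hx }

/-- The poset of generalised quotients is a complete lattice. -/
instance : CompleteLattice (GenQuot R H) :=
  completeLatticeOfInf _ fun s =>
    ⟨fun Q hQ => (le_iSup₂_of_le Q hQ le_rfl : Q.ker ≤ ⨆ Q ∈ s, Q.ker),
      fun P hP => show (⨆ Q ∈ s, Q.ker) ≤ P.ker from iSup₂_le fun _ hQ => hP hQ⟩

end GenQuot

/-- Since the kernel of `π_Q` is a right ideal, `id ⊗ π_Q` is right `A ⊗ H`-linear. -/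
theorem lTensor_proj_mul {R : Type u} {H : Type v} {A : Type w} [CommRing R] [Ring H]
    [HopfAlgebra R H] [Ring A] [Algebra R A] (Q : GenQuot R H) (x y z : A ⊗[R] H)
    (h : Q.proj.lTensor A x = Q.proj.lTensor A y) :
    Q.proj.lTensor A (x * z) = Q.proj.lTensor A (y * z) := by
  rw [← sub_eq_zero, ← map_sub, ← sub_mul]
  rw [← sub_eq_zero, ← map_sub] at h
  have hx : x - y ∈ LinearMap.range (Q.ker.subtype.lTensor A) := by
    rw [← lTensor_mkQ]; exact h
  obtain ⟨t, ht⟩ := hx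
  rw [← ht]
  clear ht h
  induction t with
  | zero => simp
  | add t₁ t₂ h₁ h₂ => rw [map_add, add_mul, map_add, h₁, h₂, add_zero]
  | tmul a i =>
    induction z with
    | zero => simp
    | add z₁ z₂ h₁ h₂ => rw [mul_add, map_add, h₁, h₂, add_zero]
    | tmul b k =>
      have : Q.proj ((i : H) * k) = 0 :=
        (Submodule.Quotient.mk_eq_zero _).2 (Q.mul_mem _ i.2 k)
      simp only [LinearMap.lTensor_tmul, Submodule.subtype_apply,
        Algebra.TensorProduct.tmul_mul_tmul, this, TensorProduct.tmul_zero]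

section Coinvariants

variable (R : Type u) (H : Type v) (A : Type w) [CommRing R] [Ring H] [HopfAlgebra R H]
  [Ring A] [Algebra R A] [ComoduleAlgebra R H A]

/-- The subalgebra `A^{co H} = {a | δ(a) = a ⊗ 1}` of coinvariants. -/
def coinvariants : Subalgebra R A :=
  AlgHom.equalizer (ComoduleAlgebra.coact (R := R) (H := H) (A := A))
    (Algebra.TensorProduct.includeLeft : A →ₐ[R] A ⊗[R] H)

variable {R H}

/-- The coaction `δ_Q = (id ⊗ π_Q) ∘ δ : A → A ⊗ Q`. -/
noncomputable def coactQuot (Q : GenQuot R H) : A →ₗ[R] A ⊗[R] Q.Carrier :=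
  Q.proj.lTensor A ∘ₗ (ComoduleAlgebra.coact (R := R) (H := H) (A := A)).toLinearMap

/-- The subalgebra `φ(Q) = A^{co Q} = {a | δ_Q(a) = a ⊗ π_Q(1)}` of `Q`-coinvariants. -/
def phi (Q : GenQuot R H) : Subalgebra R A where
  carrier := {a | coactQuot A Q a = a ⊗ₜ[R] Q.proj 1}
  mul_mem' := by
    intro a b ha hb
    simp only [Set.mem_ofPred_eq, coactQuot, LinearMap.comp_apply, AlgHom.toLinearMap_apply]
      at ha hb ⊢
    have h := lTensor_proj_mul Q (ComoduleAlgebra.coact a) (a ⊗ₜ[R] (1 : H))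
      (ComoduleAlgebra.coact b) (by rw [ha, LinearMap.lTensor_tmul])
    rw [map_mul, h]
    have h₂ : ∀ z : A ⊗[R] H, Q.proj.lTensor A (a ⊗ₜ[R] (1 : H) * z) =
        (LinearMap.mulLeft R a).rTensor Q.Carrier (Q.proj.lTensor A z) := by
      intro z
      induction z with
      | zero => simp
      | add z₁ z₂ h₁ h₂ => rw [mul_add, map_add, h₁, h₂, map_add, map_add]
      | tmul c k => simp
    rw [h₂, hb, LinearMap.rTensor_tmul, LinearMap.mulLeft_apply]
  add_mem' := by
    intro a b ha hb
    simp only [Set.mem_ofPred_eq] at ha hb ⊢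
    rw [map_add, ha, hb, TensorProduct.add_tmul]
  algebraMap_mem' := by
    intro r
    simp only [Set.mem_ofPred_eq, coactQuot, LinearMap.comp_apply, AlgHom.toLinearMap_apply,
      AlgHom.commutes, Algebra.TensorProduct.algebraMap_apply, LinearMap.lTensor_tmul]

variable {A} in
/-- `ψ(S) = ⋁ {Q | S ⊆ A^{co Q}}`, the supremum being taken in the complete lattice of generalised
quotients. -/
noncomputable def psi (S : Subalgebra R A) : GenQuot R H :=
  sSup {Q : GenQuot R H | S ≤ phi A Q}

variable {A} (H) in
/-- `S` is closed: `φ(ψ(S)) = S`. -/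
def IsClosedSubalgebra (S : Subalgebra R A) : Prop :=
  phi A (psi S : GenQuot R H) = S

/-- The cotensor product `A □_Q H ⊆ A ⊗ H`: the equaliser of `δ_Q ⊗ id` and
`id ⊗ (π_Q ⊗ id) Δ`, as maps to `A ⊗ (Q ⊗ H)`. -/
noncomputable def cotensor (Q : GenQuot R H) : Submodule R (A ⊗[R] H) :=
  LinearMap.eqLocus
    ((TensorProduct.assoc R A Q.Carrier H).toLinearMap ∘ₗ (coactQuot A Q).rTensor H)
    ((Q.proj.rTensor H ∘ₗ Coalgebra.comul (R := R) (A := H)).lTensor A)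

end Coinvariants

section Canonical

variable {R : Type u} {A : Type w} [CommRing R] [Ring A] [Algebra R A]

/-- The submodule of `S ⊗_R A` spanned by all `s b ⊗ a - s ⊗ b a` with `b ∈ B`. -/
def balancedRel {B S : Subalgebra R A} (hBS : B ≤ S) : Submodule R (S ⊗[R] A) :=
  Submodule.span R
    {x | ∃ (s : S) (b : B) (a : A),
      x = (s * Subalgebra.inclusion hBS b) ⊗ₜ[R] a - s ⊗ₜ[R] ((b : A) * a)}

/-- The tensor product `S ⊗_B A` of the right `B`-module `S` and the left `B`-module `A`, for
subalgebras `B ≤ S` of `A` (which need not be commutative). -/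
abbrev BalancedTensor {B S : Subalgebra R A} (hBS : B ≤ S) : Type w :=
  (S ⊗[R] A) ⧸ balancedRel hBS

variable (H : Type v) [Ring H] [HopfAlgebra R H] [ComoduleAlgebra R H A]

/-- The map `S ⊗_R A → A ⊗ H`, `a ⊗ b ↦ (a ⊗ 1) δ(b) = a b₍₀₎ ⊗ b₍₁₎`. -/
noncomputable def canPre (S : Subalgebra R A) : S ⊗[R] A →ₗ[R] A ⊗[R] H :=
  TensorProduct.lift ((LinearMap.mul R (A ⊗[R] H)).compl₁₂
    ((Algebra.TensorProduct.includeLeft : A →ₐ[R] A ⊗[R] H).toLinearMap ∘ₗ S.val.toLinearMap)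
    (ComoduleAlgebra.coact (R := R) (H := H) (A := A)).toLinearMap)

@[simp]
theorem canPre_tmul (S : Subalgebra R A) (s : S) (a : A) :
    canPre H S (s ⊗ₜ[R] a) = ((s : A) ⊗ₜ[R] (1 : H)) * ComoduleAlgebra.coact a := rfl

/-- The canonical map `can_S : S ⊗_B A → A ⊗ H`, `a ⊗ b ↦ a b₍₀₎ ⊗ b₍₁₎`, with `B = A^{co H}`. -/
noncomputable def can {S : Subalgebra R A} (hS : coinvariants R H A ≤ S) :
    BalancedTensor hS →ₗ[R] A ⊗[R] H :=
  (balancedRel hS).liftQ (canPre H S) <| by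
    refine Submodule.span_le.2 ?_
    rintro _ ⟨s, b, a, rfl⟩
    have hb : ComoduleAlgebra.coact (b : A) = (b : A) ⊗ₜ[R] (1 : H) := b.2
    simp only [SetLike.mem_coe, LinearMap.mem_ker, map_sub, canPre_tmul, map_mul, hb,
      MulMemClass.coe_mul, Subalgebra.coe_inclusion, ← mul_assoc,
      Algebra.TensorProduct.tmul_mul_tmul, one_mul, sub_self]

end Canonical

section CrossedProduct

variable (R : Type u) (H : Type v) (B : Type w) [CommRing R] [Ring H] [HopfAlgebra R H]
  [Ring B] [Algebra R B]

/-- The data of a crossed product `B #_σ H`: a measuring `h · b` of `B` by `H` and a normalised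
convolution invertible `2`-cocycle `σ : H ⊗ H → B` which make `B` a twisted `H`-module.  The
comultiplications are written out with representations `Δ(h) = ∑ h₍₁₎ ⊗ h₍₂₎`; all sums are
independent of the representation. -/
structure CrossedSystem where
  /-- the action `h · b` -/
  act : H →ₗ[R] B →ₗ[R] B
  /-- the cocycle -/
  σ : H ⊗[R] H →ₗ[R] B
  one_act : ∀ b : B, act 1 b = b
  act_one : ∀ h : H, act h 1 = algebraMap R B (Coalgebra.counit h)
  act_mul : ∀ (h : H) (a b : B), act h (a * b) =
    ∑ i ∈ (ℛ R h).index, act ((ℛ R h).left i) a * act ((ℛ R h).right i) b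
  isUnit_σ : IsUnit (WithConv.toConv σ)
  σ_one_left : ∀ h : H, σ (1 ⊗ₜ h) = algebraMap R B (Coalgebra.counit h)
  σ_one_right : ∀ h : H, σ (h ⊗ₜ 1) = algebraMap R B (Coalgebra.counit h)
  twisted : ∀ (h k : H) (b : B),
    ∑ i ∈ (ℛ R h).index, ∑ j ∈ (ℛ R k).index,
        act ((ℛ R h).left i) (act ((ℛ R k).left j) b) *
          σ ((ℛ R h).right i ⊗ₜ (ℛ R k).right j) =
      ∑ i ∈ (ℛ R h).index, ∑ j ∈ (ℛ R k).index,
        σ ((ℛ R h).left i ⊗ₜ (ℛ R k).left j) *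
          act ((ℛ R h).right i * (ℛ R k).right j) b
  cocycle : ∀ h k m : H,
    ∑ i ∈ (ℛ R h).index, ∑ j ∈ (ℛ R k).index, ∑ l ∈ (ℛ R m).index,
        act ((ℛ R h).left i) (σ ((ℛ R k).left j ⊗ₜ (ℛ R m).left l)) *
          σ ((ℛ R h).right i ⊗ₜ ((ℛ R k).right j * (ℛ R m).right l)) =
      ∑ i ∈ (ℛ R h).index, ∑ j ∈ (ℛ R k).index,
        σ ((ℛ R h).left i ⊗ₜ (ℛ R k).left j) *
          σ (((ℛ R h).right i * (ℛ R k).right j) ⊗ₜ m)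

variable {R H B}

/-- The product `(a # h)(b # k) = ∑ a (h₍₁₎ · b) σ(h₍₂₎ ⊗ k₍₁₎) # h₍₃₎ k₍₂₎` in `B #_σ H`, whose
underlying `R`-module is `B ⊗ H`.  Here `h₍₂₎ ⊗ h₍₃₎` is the comultiplication of the right factor
of `Δ(h)`. -/
noncomputable def CrossedSystem.mul (X : CrossedSystem R H B) (a : B) (h : H) (b : B) (k : H) :
    B ⊗[R] H :=
  ∑ i ∈ (ℛ R h).index, ∑ j ∈ (ℛ R ((ℛ R h).right i)).index, ∑ l ∈ (ℛ R k).index,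
    (a * X.act ((ℛ R h).left i) b *
        X.σ ((ℛ R ((ℛ R h).right i)).left j ⊗ₜ (ℛ R k).left l)) ⊗ₜ[R]
      ((ℛ R ((ℛ R h).right i)).right j * (ℛ R k).right l)

/-- An isomorphism `B #_σ H ≅ A` of right `H`-comodule algebras, where `B #_σ H` is the module
`B ⊗ H` with the product `CrossedSystem.mul`, the unit `1 # 1` and the coaction `id ⊗ Δ`. -/
structure CrossedProductIso (X : CrossedSystem R H B) (A : Type w') [Ring A] [Algebra R A]
    [ComoduleAlgebra R H A] where
  /-- the underlying linear isomorphism -/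
  toEquiv : B ⊗[R] H ≃ₗ[R] A
  map_one : toEquiv (1 ⊗ₜ 1) = 1
  map_mul : ∀ (a : B) (h : H) (b : B) (k : H),
    toEquiv (X.mul a h b k) = toEquiv (a ⊗ₜ h) * toEquiv (b ⊗ₜ k)
  map_coact : ∀ (b : B) (h : H),
    (ComoduleAlgebra.coact (toEquiv (b ⊗ₜ h)) : A ⊗[R] H) =
      toEquiv.toLinearMap.rTensor H
        ((TensorProduct.assoc R B H H).symm (b ⊗ₜ Coalgebra.comul (R := R) h))

/-- `A / B`, with `B = A^{co H}`, is an `H`-crossed product extension: `A ≅ B #_σ H` as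
`H`-comodule algebras for some crossed system on `B`. -/
def IsCrossedProduct (R : Type u) (H : Type v) (A : Type w) [CommRing R] [Ring H]
    [HopfAlgebra R H] [Ring A] [Algebra R A] [ComoduleAlgebra R H A] : Prop :=
  ∃ X : CrossedSystem R H (coinvariants R H A), Nonempty (CrossedProductIso X A)

end CrossedProduct

end HopfGalois

/-!
A crossed product `A ≅ B #_σ H` has the cleaving map `j : h ↦ 1 # h`, a colinear and convolution
invertible map `H → A`. In terms of `e : B ⊗ H ≅ A`, the map `a ⊗ h ↦ a j(h₍₁₎) ⊗ h₍₂₎` is the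
composite of the twists by `σ` and by `id : H → H`. The antipode inverts `id`, so this map is
bijective, and evaluating its inverse at `1 ⊗ h` and applying the counit gives the convolution
inverse of `j`.

For any cleaving map `j` the bijection `T : a ⊗ h ↦ a j(h₍₁₎) ⊗ h₍₂₎ = (a ⊗ 1) δ(j(h))` of `A ⊗ H`
carries the two maps defining `A □_Q H` to a bijection (the twist of `A ⊗ Q` by `j`) composed with
`δ_Q ⊗ id` and with `(a ↦ a ⊗ π_Q(1)) ⊗ id` respectively. As `H` is flat, `T` maps `A^{co Q} ⊗ H`
onto `A □_Q H`. With `Q = H` this shows that `A` is generated by `j(H)` as a left module over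
`A^{co H}`, so `S ⊗ H → S ⊗_B A`, `s ⊗ h ↦ s ⊗ j(h)`, is surjective, and its composite with `can_S`
is the restriction of the injective map `T` to `S ⊗ H`. Hence `can_S` is injective with image
`T(S ⊗ H)`, which is `A □_Q H = T(A^{co Q} ⊗ H)` exactly when `S = A^{co Q}`, because the counit
recovers a submodule `N` of `A` from `N ⊗ H`.
-/

namespace HopfGalois

open Coalgebra TensorProduct WithConv

section Coextend

variable {R C M N P V : Type*} [CommSemiring R] [AddCommMonoid C] [Module R C]
  [AddCommMonoid M] [Module R M] [AddCommMonoid N] [Module R N] [AddCommMonoid P] [Module R P]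
  [AddCommMonoid V] [Module R V]

/-- The map `m ⊗ c ↦ (m ⊗ c₍₀₎) ⊗ c₍₁₎` induced by `D : c ↦ c₍₀₎ ⊗ c₍₁₎`. For `D = Δ` it is the
coaction of the cofree right `C`-comodule `M ⊗ C`. -/
noncomputable def cofreeCoact (M : Type*) [AddCommMonoid M] [Module R M]
    (D : C →ₗ[R] C ⊗[R] V) : M ⊗[R] C →ₗ[R] (M ⊗[R] C) ⊗[R] V :=
  (TensorProduct.assoc R M C V).symm.toLinearMap ∘ₗ D.lTensor M

theorem cofreeCoact_tmul (D : C →ₗ[R] C ⊗[R] V) (m : M) (c : C) :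
    cofreeCoact M D (m ⊗ₜ c) = (TensorProduct.mk R M C m).rTensor V (D c) := by
  suffices ∀ z, (TensorProduct.assoc R M C V).symm (m ⊗ₜ z) =
      (TensorProduct.mk R M C m).rTensor V z from this (D c)
  intro z
  induction z with
  | zero => simp
  | add x y hx hy => simp only [tmul_add, map_add, hx, hy]
  | tmul x y => rfl

theorem cofreeCoact_comp_rTensor (D : C →ₗ[R] C ⊗[R] V) (φ : M →ₗ[R] N) :
    cofreeCoact N D ∘ₗ φ.rTensor C = (φ.rTensor C).rTensor V ∘ₗ cofreeCoact M D := by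
  refine TensorProduct.ext' fun m c => ?_
  simp only [LinearMap.comp_apply, LinearMap.rTensor_tmul, cofreeCoact_tmul,
    ← LinearMap.rTensor_comp_apply]
  rfl

theorem rTensor_assoc_comp_cofreeCoact (D : C →ₗ[R] C ⊗[R] V) :
    (TensorProduct.assoc R M N C).toLinearMap.rTensor V ∘ₗ cofreeCoact (M ⊗[R] N) D =
      cofreeCoact M (cofreeCoact N D) ∘ₗ (TensorProduct.assoc R M N C).toLinearMap := by
  refine TensorProduct.ext_threefold fun m n c => ?_
  simp only [LinearMap.comp_apply, LinearEquiv.coe_coe, TensorProduct.assoc_tmul,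
    cofreeCoact_tmul, ← LinearMap.rTensor_comp_apply]
  rfl

theorem rTensor_lTensor_comp_cofreeCoact (D : C →ₗ[R] C ⊗[R] V) (φ : C →ₗ[R] P) :
    (φ.lTensor M).rTensor V ∘ₗ cofreeCoact M D =
      (TensorProduct.assoc R M P V).symm.toLinearMap ∘ₗ (φ.rTensor V ∘ₗ D).lTensor M := by
  rw [cofreeCoact, ← LinearMap.comp_assoc, LinearMap.rTensor_lTensor_comp_assoc_symm,
    LinearMap.comp_assoc, ← LinearMap.lTensor_comp]

variable [Coalgebra R C]

/-- The right `C`-comodule map `m ⊗ c ↦ u(m ⊗ c₍₁₎) ⊗ c₍₂₎` between cofree comodules determined by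
the linear map `u`. -/
noncomputable def coextend (u : M ⊗[R] C →ₗ[R] N) : M ⊗[R] C →ₗ[R] N ⊗[R] C :=
  u.rTensor C ∘ₗ cofreeCoact M comul

theorem coextend_tmul (u : M ⊗[R] C →ₗ[R] N) (m : M) (c : C) :
    coextend u (m ⊗ₜ c) = (u ∘ₗ TensorProduct.mk R M C m).rTensor C (comul c) := by
  rw [coextend, LinearMap.comp_apply, cofreeCoact_tmul, LinearMap.rTensor_comp_apply]

theorem rTensor_comp_coextend (φ : N →ₗ[R] P) (u : M ⊗[R] C →ₗ[R] N) :
    φ.rTensor C ∘ₗ coextend u = coextend (φ ∘ₗ u) := by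
  rw [coextend, coextend, LinearMap.rTensor_comp, LinearMap.comp_assoc]

theorem coextend_comp_rTensor (u : N ⊗[R] C →ₗ[R] P) (φ : M →ₗ[R] N) :
    coextend u ∘ₗ φ.rTensor C = coextend (u ∘ₗ φ.rTensor C) := by
  rw [coextend, coextend, LinearMap.rTensor_comp, LinearMap.comp_assoc, LinearMap.comp_assoc,
    cofreeCoact_comp_rTensor]

theorem cofreeCoact_comp_coextend (u : M ⊗[R] C →ₗ[R] N) {D : C →ₗ[R] C ⊗[R] V}
    (hD : cofreeCoact C D ∘ₗ comul = comul.rTensor V ∘ₗ D) :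
    cofreeCoact N D ∘ₗ coextend u = (coextend u).rTensor V ∘ₗ cofreeCoact M D := by
  refine TensorProduct.ext' fun m c => ?_
  let w : C →ₗ[R] N := u ∘ₗ TensorProduct.mk R M C m
  have hu : coextend u ∘ₗ TensorProduct.mk R M C m = w.rTensor C ∘ₗ comul :=
    LinearMap.ext (coextend_tmul u m)
  calc cofreeCoact N D (coextend u (m ⊗ₜ c))
      = (cofreeCoact N D ∘ₗ w.rTensor C) (comul c) := by rw [coextend_tmul]; rfl
    _ = (w.rTensor C).rTensor V ((cofreeCoact C D ∘ₗ comul) c) := by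
        rw [cofreeCoact_comp_rTensor]; rfl
    _ = (w.rTensor C ∘ₗ comul).rTensor V (D c) := by
        rw [hD, LinearMap.rTensor_comp_apply]; rfl
    _ = (coextend u).rTensor V (cofreeCoact M D (m ⊗ₜ c)) := by
        rw [← hu, cofreeCoact_tmul, LinearMap.rTensor_comp_apply]

variable (C) in
theorem cofreeCoact_comul_comp_comul :
    cofreeCoact C comul ∘ₗ comul = comul.rTensor C ∘ₗ comul (R := R) (A := C) :=
  LinearMap.ext coassoc_symm_apply

theorem coextend_comp_coextend (v : N ⊗[R] C →ₗ[R] P) (u : M ⊗[R] C →ₗ[R] N) :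
    coextend v ∘ₗ coextend u = coextend (v ∘ₗ coextend u) := by
  rw [← rTensor_comp_coextend, coextend, LinearMap.comp_assoc,
    cofreeCoact_comp_coextend u (cofreeCoact_comul_comp_comul C)]
  rfl

/-- The map `m ⊗ c ↦ ε(c) m`. -/
noncomputable def applyCounit (R C M : Type*) [CommSemiring R] [AddCommMonoid C] [Module R C]
    [Coalgebra R C] [AddCommMonoid M] [Module R M] : M ⊗[R] C →ₗ[R] M :=
  (TensorProduct.rid R M).toLinearMap ∘ₗ (counit (R := R) (A := C)).lTensor M

@[simp]
theorem applyCounit_tmul (m : M) (c : C) : applyCounit R C M (m ⊗ₜ c) = counit (R := R) c • m := by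
  simp [applyCounit]

theorem applyCounit_comp_rTensor (φ : M →ₗ[R] N) :
    applyCounit R C N ∘ₗ φ.rTensor C = φ ∘ₗ applyCounit R C M :=
  TensorProduct.ext' fun m c => by simp

theorem applyCounit_comul (c : C) : applyCounit R C C (comul c) = c := by
  rw [applyCounit, LinearMap.comp_apply, lTensor_counit_comul]
  simp

theorem applyCounit_comp_coextend (u : M ⊗[R] C →ₗ[R] N) :
    applyCounit R C N ∘ₗ coextend u = u := by
  refine TensorProduct.ext' fun m c => ?_
  rw [LinearMap.comp_apply, coextend_tmul, ← LinearMap.comp_apply, applyCounit_comp_rTensor,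
    LinearMap.comp_apply, applyCounit_comul]
  rfl

variable (R C M) in
theorem coextend_applyCounit : coextend (applyCounit R C M) = LinearMap.id := by
  refine TensorProduct.ext' fun m c => ?_
  have h : applyCounit R C M ∘ₗ TensorProduct.mk R M C m =
      LinearMap.toSpanSingleton R M m ∘ₗ counit :=
    LinearMap.ext (applyCounit_tmul m)
  rw [coextend_tmul, h, LinearMap.rTensor_comp_apply, rTensor_counit_comul]
  simp

theorem map_applyCounit_range_rTensor_subtype (N : Submodule R M)
    (h : Function.Surjective (counit (R := R) (A := C))) :
    (LinearMap.range (N.subtype.rTensor C)).map (applyCounit R C M) = N := by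
  rw [← LinearMap.range_comp, applyCounit_comp_rTensor, LinearMap.range_comp_of_range_eq_top,
    Submodule.range_subtype]
  refine LinearMap.range_eq_top.2 fun n => ?_
  obtain ⟨c, hc⟩ := h 1
  exact ⟨n ⊗ₜ c, by rw [applyCounit_tmul, hc, one_smul]⟩

end Coextend

section TensorCoalgebra

variable {R C K M N P : Type*} [CommSemiring R] [AddCommMonoid C] [Module R C] [Coalgebra R C]
  [AddCommMonoid K] [Module R K] [Coalgebra R K] [AddCommMonoid M] [Module R M]
  [AddCommMonoid N] [Module R N] [AddCommMonoid P] [Module R P]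

theorem cofreeCoact_comp_comul_tensorProduct :
    cofreeCoact (C ⊗[R] K) (cofreeCoact C comul) ∘ₗ comul =
      comul.rTensor K ∘ₗ cofreeCoact C (comul (R := R) (A := K)) := by
  refine TensorProduct.ext' fun c k => ?_
  have natural (x : C ⊗[R] C) (z : K ⊗[R] K) :
      cofreeCoact (C ⊗[R] K) (cofreeCoact C comul)
          (TensorProduct.tensorTensorTensorComm R C C K K (x ⊗ₜ z)) =
        ((TensorProduct.tensorTensorTensorComm R C C K K).toLinearMap ∘ₗ
          TensorProduct.mk R _ _ x).rTensor K (cofreeCoact K comul z) := by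
    induction x with
    | zero => simp
    | add x y hx hy =>
      simp only [add_tmul, map_add, LinearMap.comp_add, LinearMap.rTensor_add,
        LinearMap.add_apply, hx, hy]
    | tmul c₁ c₂ =>
      induction z with
      | zero => simp
      | add x y hx hy => simp only [tmul_add, map_add, hx, hy]
      | tmul k₁ k₂ =>
        simp only [tensorTensorTensorComm_tmul, cofreeCoact_tmul, ← LinearMap.rTensor_comp_apply]
        rfl
  have h := natural (comul c) (comul k)
  rw [← LinearMap.comp_apply (cofreeCoact K _), cofreeCoact_comul_comp_comul] at h
  refine Eq.trans h ?_
  rw [LinearMap.comp_apply, LinearMap.comp_apply, cofreeCoact_tmul, ← LinearMap.rTensor_comp_apply,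
    ← LinearMap.rTensor_comp_apply]
  rfl

theorem coextend_lTensor_comp_coextend_comp_assoc (φ : C ⊗[R] K →ₗ[R] P)
    (u : M ⊗[R] (C ⊗[R] K) →ₗ[R] N) :
    coextend (φ.lTensor N ∘ₗ coextend u ∘ₗ (TensorProduct.assoc R M C K).toLinearMap) =
      (TensorProduct.assoc R N P K).symm.toLinearMap ∘ₗ (coextend φ).lTensor N ∘ₗ
        coextend u ∘ₗ (TensorProduct.assoc R M C K).toLinearMap := by
  let D : C ⊗[R] K →ₗ[R] (C ⊗[R] K) ⊗[R] K := cofreeCoact C comul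
  let α := (TensorProduct.assoc R M C K).toLinearMap
  calc coextend (φ.lTensor N ∘ₗ coextend u ∘ₗ α)
    _ = (φ.lTensor N).rTensor K ∘ₗ (coextend u).rTensor K ∘ₗ cofreeCoact M D ∘ₗ α := by
        rw [coextend, LinearMap.rTensor_comp, LinearMap.rTensor_comp, LinearMap.comp_assoc,
          LinearMap.comp_assoc, rTensor_assoc_comp_cofreeCoact]
    _ = (φ.lTensor N).rTensor K ∘ₗ cofreeCoact N D ∘ₗ coextend u ∘ₗ α := by
        rw [← LinearMap.comp_assoc α,
          ← cofreeCoact_comp_coextend u cofreeCoact_comp_comul_tensorProduct, LinearMap.comp_assoc]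
    _ = _ := by
        rw [← LinearMap.comp_assoc, rTensor_lTensor_comp_cofreeCoact, LinearMap.comp_assoc]
        rfl

end TensorCoalgebra

section Twist

variable {R C E M N : Type*} [CommSemiring R] [AddCommMonoid C] [Module R C]
  [AddCommMonoid M] [Module R M] [AddCommMonoid N] [Module R N] [Semiring E] [Algebra R E]
  (ρ : Eᵐᵒᵖ →ₐ[R] Module.End R M)

/-- The map `m ⊗ c ↦ m f(c)`, for a linear map `f : C → E` and a right `E`-module structure on `M`,
encoded as a representation `ρ` of the opposite algebra. -/
noncomputable def actMap (f : C →ₗ[R] E) : M ⊗[R] C →ₗ[R] M :=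
  TensorProduct.lift (ρ.toLinearMap ∘ₗ (MulOpposite.opLinearEquiv R).toLinearMap ∘ₗ f).flip

@[simp]
theorem actMap_tmul (f : C →ₗ[R] E) (m : M) (c : C) :
    actMap ρ f (m ⊗ₜ c) = ρ (MulOpposite.op (f c)) m := rfl

variable [Coalgebra R C]

/-- The twist `m ⊗ c ↦ m f(c₍₁₎) ⊗ c₍₂₎` of `M ⊗ C` by a linear map `f : C → E`. -/
noncomputable def twist (f : C →ₗ[R] E) : M ⊗[R] C →ₗ[R] M ⊗[R] C :=
  coextend (actMap ρ f)

theorem actMap_one : actMap ρ (1 : WithConv (C →ₗ[R] E)).ofConv = applyCounit R C M := by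
  refine TensorProduct.ext' fun m c => ?_
  change ρ (algebraMap R Eᵐᵒᵖ (counit c)) m = _
  rw [AlgHom.commutes, applyCounit_tmul, Module.algebraMap_end_apply]

theorem actMap_mul (f g : WithConv (C →ₗ[R] E)) :
    actMap ρ (f * g).ofConv = actMap ρ g.ofConv ∘ₗ twist ρ f.ofConv := by
  refine TensorProduct.ext' fun m c => ?_
  rw [LinearMap.comp_apply, twist, coextend_tmul, actMap_tmul, LinearMap.convMul_apply]
  induction comul (R := R) c with
  | zero => simp
  | add x y hx hy => simp only [map_add, MulOpposite.op_add, LinearMap.add_apply, hx, hy]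
  | tmul x y => simp

theorem twist_one : twist ρ (1 : WithConv (C →ₗ[R] E)).ofConv = LinearMap.id := by
  rw [twist, actMap_one, coextend_applyCounit]

theorem twist_mul (f g : WithConv (C →ₗ[R] E)) :
    twist ρ (f * g).ofConv = twist ρ g.ofConv ∘ₗ twist ρ f.ofConv := by
  rw [twist, twist, twist, coextend_comp_coextend, actMap_mul, ← twist]

theorem twist_bijective {f : C →ₗ[R] E} (hf : IsUnit (toConv f)) :
    Function.Bijective (twist ρ f) := by
  obtain ⟨g, hfg, hgf⟩ := isUnit_iff_exists.1 hf
  have inverse {f g : WithConv (C →ₗ[R] E)} (h : f * g = 1) (x : M ⊗[R] C) :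
      twist ρ g.ofConv (twist ρ f.ofConv x) = x := by
    rw [← LinearMap.comp_apply, ← twist_mul, h, twist_one, LinearMap.id_apply]
  exact Function.bijective_iff_has_inverse.2 ⟨twist ρ g.ofConv, inverse hfg, inverse hgf⟩

variable {ρ} in
theorem rTensor_comp_twist {ρN : Eᵐᵒᵖ →ₐ[R] Module.End R N} {φ : M →ₗ[R] N}
    (hφ : ∀ x m, φ (ρ x m) = ρN x (φ m)) (f : C →ₗ[R] E) :
    φ.rTensor C ∘ₗ twist ρ f = twist ρN f ∘ₗ φ.rTensor C := by
  have h : φ ∘ₗ actMap ρ f = actMap ρN f ∘ₗ φ.rTensor C :=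
    TensorProduct.ext' fun m c => hφ (MulOpposite.op (f c)) m
  rw [twist, rTensor_comp_coextend, h, twist, coextend_comp_rTensor]

/-- The right regular representation of an algebra `E`, i.e. `E` as a right `E`-module. -/
noncomputable abbrev rightRegular (R E : Type*) [CommSemiring R] [Semiring E] [Algebra R E] :
    Eᵐᵒᵖ →ₐ[R] Module.End R E :=
  Algebra.lsmul R R E

theorem rTensor_mulLeft_comp_twist (f : C →ₗ[R] E) (a : E) :
    (LinearMap.mulLeft R a).rTensor C ∘ₗ twist (rightRegular R E) f =
      twist (rightRegular R E) f ∘ₗ (LinearMap.mulLeft R a).rTensor C :=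
  rTensor_comp_twist (fun x m => (mul_assoc a m x.unop).symm) f

omit [Coalgebra R C] in
theorem actMap_comp_mk_one {F : E ⊗[R] C →ₗ[R] E}
    (hF : ∀ a, F ∘ₗ (LinearMap.mulLeft R a).rTensor C = LinearMap.mulLeft R a ∘ₗ F) :
    actMap (rightRegular R E) (F ∘ₗ TensorProduct.mk R E C 1) = F :=
  TensorProduct.ext' fun a c => by simpa using (LinearMap.congr_fun (hF a) (1 ⊗ₜ c)).symm

omit [Coalgebra R C] in
theorem actMap_rightRegular_injective :
    Function.Injective (actMap (rightRegular R E) : (C →ₗ[R] E) → E ⊗[R] C →ₗ[R] E) :=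
  fun f g h => LinearMap.ext fun c => by simpa using LinearMap.congr_fun h (1 ⊗ₜ c)

theorem exists_actMap_comp_twist_eq_applyCounit {f : C →ₗ[R] E}
    (hf : Function.Bijective (twist (rightRegular R E) f)) :
    ∃ g, actMap (rightRegular R E) g ∘ₗ twist (rightRegular R E) f = applyCounit R C E := by
  let T : E ⊗[R] C ≃ₗ[R] E ⊗[R] C := LinearEquiv.ofBijective _ hf
  have symm_twist : T.symm.toLinearMap ∘ₗ twist (rightRegular R E) f = LinearMap.id := T.symm_comp
  have twist_symm : twist (rightRegular R E) f ∘ₗ T.symm.toLinearMap = LinearMap.id := T.comp_symm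
  have symm_mulLeft (a : E) : T.symm.toLinearMap ∘ₗ (LinearMap.mulLeft R a).rTensor C =
      (LinearMap.mulLeft R a).rTensor C ∘ₗ T.symm.toLinearMap := by
    rw [LinearEquiv.toLinearMap_symm_comp_eq]
    change _ = twist (rightRegular R E) f ∘ₗ _
    rw [← LinearMap.comp_assoc, ← rTensor_mulLeft_comp_twist, LinearMap.comp_assoc, twist_symm,
      LinearMap.comp_id]
  refine ⟨(applyCounit R C E ∘ₗ T.symm.toLinearMap) ∘ₗ TensorProduct.mk R E C 1, ?_⟩
  rw [actMap_comp_mk_one fun a => ?_]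
  · rw [LinearMap.comp_assoc, symm_twist, LinearMap.comp_id]
  · rw [LinearMap.comp_assoc, symm_mulLeft, ← LinearMap.comp_assoc, applyCounit_comp_rTensor,
      LinearMap.comp_assoc]

theorem isUnit_toConv_of_twist_bijective {f : C →ₗ[R] E}
    (hf : Function.Bijective (twist (rightRegular R E) f)) : IsUnit (toConv f) := by
  obtain ⟨g, hg⟩ := exists_actMap_comp_twist_eq_applyCounit hf
  have left_inv : twist (rightRegular R E) g ∘ₗ twist (rightRegular R E) f = LinearMap.id := by
    rw [← coextend_applyCounit, ← hg, twist, twist, coextend_comp_coextend]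
  have right_inv : twist (rightRegular R E) f ∘ₗ twist (rightRegular R E) g = LinearMap.id :=
    (LinearMap.cancel_right hf.surjective).1 <| by
      rw [LinearMap.comp_assoc, left_inv, LinearMap.comp_id, LinearMap.id_comp]
  have eq_one {h : WithConv (C →ₗ[R] E)}
      (hh : actMap (rightRegular R E) h.ofConv = applyCounit R C E) : h = 1 :=
    WithConv.ofConv_injective (actMap_rightRegular_injective (hh.trans (actMap_one _).symm))
  refine isUnit_iff_exists.2 ⟨toConv g, eq_one ?_, eq_one ?_⟩
  · rw [actMap_mul, ← hg]
  · rw [actMap_mul, ← applyCounit_comp_coextend (actMap _ f), LinearMap.comp_assoc]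
    exact congrArg (applyCounit R C E ∘ₗ ·) right_inv

end Twist

section Action

variable {R E F M N : Type*} [CommSemiring R] [Semiring E] [Algebra R E] [Semiring F] [Algebra R F]
  [AddCommMonoid M] [Module R M] [AddCommMonoid N] [Module R N]

/-- The tensor product of right modules over `E` and `F`, as a right `E ⊗ F`-module. -/
noncomputable def tensorRightAct (ρ : Eᵐᵒᵖ →ₐ[R] Module.End R M) (τ : Fᵐᵒᵖ →ₐ[R] Module.End R N) :
    (E ⊗[R] F)ᵐᵒᵖ →ₐ[R] Module.End R (M ⊗[R] N) :=
  (Module.endTensorEndAlgHom.comp (Algebra.TensorProduct.map ρ τ)).comp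
    (Algebra.TensorProduct.opAlgEquiv R R E F).symm.toAlgHom

theorem tensorRightAct_op_tmul (ρ : Eᵐᵒᵖ →ₐ[R] Module.End R M) (τ : Fᵐᵒᵖ →ₐ[R] Module.End R N)
    (x : E) (y : F) (m : M) (n : N) :
    tensorRightAct ρ τ (MulOpposite.op (x ⊗ₜ y)) (m ⊗ₜ n) =
      ρ (MulOpposite.op x) m ⊗ₜ τ (MulOpposite.op y) n := rfl

theorem tensorRightAct_map {M' N' : Type*} [AddCommMonoid M'] [Module R M'] [AddCommMonoid N']
    [Module R N'] {ρ : Eᵐᵒᵖ →ₐ[R] Module.End R M} {ρ' : Eᵐᵒᵖ →ₐ[R] Module.End R M'}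
    {τ : Fᵐᵒᵖ →ₐ[R] Module.End R N} {τ' : Fᵐᵒᵖ →ₐ[R] Module.End R N'}
    {φ : M →ₗ[R] M'} {χ : N →ₗ[R] N'} (hφ : ∀ x m, φ (ρ x m) = ρ' x (φ m))
    (hχ : ∀ y n, χ (τ y n) = τ' y (χ n)) (z : (E ⊗[R] F)ᵐᵒᵖ) (t : M ⊗[R] N) :
    TensorProduct.map φ χ (tensorRightAct ρ τ z t) =
      tensorRightAct ρ' τ' z (TensorProduct.map φ χ t) := by
  obtain ⟨z, rfl⟩ := MulOpposite.op_surjective z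
  induction z with
  | zero => simp
  | add x y hx hy => simp only [MulOpposite.op_add, map_add, LinearMap.add_apply, hx, hy]
  | tmul x y =>
    induction t with
    | zero => simp
    | add s t hs ht => simp only [map_add, hs, ht]
    | tmul m n => simp only [tensorRightAct_op_tmul, TensorProduct.map_tmul, hφ, hχ]

variable (R) in
theorem tensorRightAct_rightRegular (z t : E ⊗[R] F) :
    tensorRightAct (rightRegular R E) (rightRegular R F) (MulOpposite.op z) t = t * z := by
  induction z with
  | zero => simp
  | add x y hx hy => simp only [MulOpposite.op_add, map_add, LinearMap.add_apply, mul_add, hx, hy]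
  | tmul x y =>
    induction t with
    | zero => simp
    | add s t hs ht => simp only [map_add, add_mul, hs, ht]
    | tmul a b => simp [tensorRightAct_op_tmul]

end Action

namespace GenQuot

variable {R : Type u} {H : Type v} [CommRing R] [Ring H] [HopfAlgebra R H]

/-- The right `H`-module structure of a generalised quotient `Q`. -/
noncomputable def rightAct (Q : GenQuot R H) : Hᵐᵒᵖ →ₐ[R] Module.End R Q.Carrier :=
  AlgHom.ofLinearMap
    ((Q.ker.liftQ ((LinearMap.mul R H).compr₂ Q.proj) fun x hx => LinearMap.ext fun h =>
      (Submodule.Quotient.mk_eq_zero _).2 (Q.mul_mem x hx h)).flip ∘ₗ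
        (MulOpposite.opLinearEquiv R).symm.toLinearMap)
    (Submodule.linearMap_qext _ <| LinearMap.ext fun x => congrArg Q.proj (mul_one x))
    fun h k => Submodule.linearMap_qext _ <| LinearMap.ext fun x =>
      congrArg Q.proj (mul_assoc x k.unop h.unop).symm

theorem proj_rightRegular (Q : GenQuot R H) (h : Hᵐᵒᵖ) (x : H) :
    Q.proj (rightRegular R H h x) = Q.rightAct h (Q.proj x) := rfl

end GenQuot

section CoactRightAct

variable {R : Type u} {H : Type v} {A : Type w} [CommRing R] [Ring H] [HopfAlgebra R H]
  [Ring A] [Algebra R A] [ComoduleAlgebra R H A]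

variable (A) in
/-- The diagonal right `A`-module structure `(a ⊗ q) b = a b₍₀₎ ⊗ q b₍₁₎` on `A ⊗ Q`. -/
noncomputable def coactRightAct (Q : GenQuot R H) :
    Aᵐᵒᵖ →ₐ[R] Module.End R (A ⊗[R] Q.Carrier) :=
  (tensorRightAct (rightRegular R A) Q.rightAct).comp (AlgHom.op ComoduleAlgebra.coact)

theorem lTensor_proj_mul_coact (Q : GenQuot R H) (z : A ⊗[R] H) (a : A) :
    Q.proj.lTensor A (z * ComoduleAlgebra.coact a) =
      coactRightAct A Q (MulOpposite.op a) (Q.proj.lTensor A z) := by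
  rw [← tensorRightAct_rightRegular R]
  exact tensorRightAct_map (φ := LinearMap.id) (fun _ _ => rfl) Q.proj_rightRegular _ z

theorem coactQuot_rightRegular (Q : GenQuot R H) (b : Aᵐᵒᵖ) (a : A) :
    coactQuot A Q (rightRegular R A b a) = coactRightAct A Q b (coactQuot A Q a) := by
  have h : rightRegular R A b a = a * b.unop := rfl
  rw [h, coactQuot, LinearMap.comp_apply, AlgHom.toLinearMap_apply, map_mul, lTensor_proj_mul_coact]
  rfl

end CoactRightAct

section Cleaving

variable {R : Type u} {H : Type v} {A : Type w} [CommRing R] [Ring H] [HopfAlgebra R H]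
  [Ring A] [Algebra R A]

theorem range_rTensor_val_injective :
    Function.Injective fun S : Subalgebra R A => LinearMap.range (S.val.toLinearMap.rTensor H) :=
  fun S T h => Subalgebra.toSubmodule_injective <| by
    rw [← map_applyCounit_range_rTensor_subtype (Subalgebra.toSubmodule S)
        (Bialgebra.counit_surjective (R := R) (A := H)),
      ← map_applyCounit_range_rTensor_subtype (Subalgebra.toSubmodule T)
        (Bialgebra.counit_surjective (R := R) (A := H))]
    exact congrArg (Submodule.map _) h

variable [ComoduleAlgebra R H A]

variable (A) in
/-- The map `a ↦ a ⊗ π_Q(1)`. -/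
noncomputable def tmulProjOne (Q : GenQuot R H) : A →ₗ[R] A ⊗[R] Q.Carrier :=
  (TensorProduct.mk R A Q.Carrier).flip (Q.proj 1)

variable (A) in
theorem exact_phi_val (Q : GenQuot R H) :
    Function.Exact (phi A Q).val.toLinearMap (coactQuot A Q - tmulProjOne A Q) := by
  intro a
  rw [LinearMap.sub_apply, sub_eq_zero]
  exact ⟨fun h => ⟨⟨a, h⟩, rfl⟩, by rintro ⟨b, rfl⟩; exact b.2⟩

theorem mem_cotensor_iff {Q : GenQuot R H} {x : A ⊗[R] H} :
    x ∈ cotensor A Q ↔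
      (coactQuot A Q).rTensor H x = (Q.proj.lTensor A).rTensor H (cofreeCoact A comul x) := by
  rw [← LinearMap.comp_apply, rTensor_lTensor_comp_cofreeCoact, LinearMap.comp_apply,
    LinearEquiv.coe_coe, LinearEquiv.eq_symm_apply]
  rfl

theorem coact_mem_cotensor (Q : GenQuot R H) (a : A) : ComoduleAlgebra.coact a ∈ cotensor A Q := by
  rw [mem_cotensor_iff, coactQuot, LinearMap.rTensor_comp_apply, cofreeCoact, LinearMap.comp_apply,
    ← ComoduleAlgebra.coassoc, LinearEquiv.coe_coe, LinearEquiv.symm_apply_apply]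

theorem GenQuot.ker_top : (⊤ : GenQuot R H).ker = ⊥ := by
  change (⨆ Q ∈ (∅ : Set (GenQuot R H)), Q.ker) = ⊥
  simp only [Set.mem_empty_iff_false, iSup_false, iSup_bot]

variable (R H A) in
theorem phi_top_le_coinvariants : phi A (⊤ : GenQuot R H) ≤ coinvariants R H A := fun _ ha =>
  ((⊤ : GenQuot R H).ker.quotEquivOfEqBot GenQuot.ker_top).symm.lTensor A |>.injective ha

/-- A cleaving map of a right `H`-comodule algebra `A`: a convolution invertible right `H`-comodule
map `H → A`. It is not required to preserve the unit. -/
structure IsCleaving (j : H →ₗ[R] A) : Prop where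
  colinear : (ComoduleAlgebra.coact (R := R)).toLinearMap ∘ₗ j = j.rTensor H ∘ₗ comul
  isUnit : IsUnit (toConv j)

namespace IsCleaving

variable {j : H →ₗ[R] A}

theorem twist_tmul (hj : IsCleaving j) (a : A) (h : H) :
    twist (rightRegular R A) j (a ⊗ₜ h) = (a ⊗ₜ[R] (1 : H)) * ComoduleAlgebra.coact (j h) := by
  have coact_j : ComoduleAlgebra.coact (j h) = j.rTensor H (comul h) :=
    LinearMap.congr_fun hj.colinear h
  rw [twist, coextend_tmul, coact_j]
  induction comul (R := R) h with
  | zero => simp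
  | add x y hx hy => simp only [map_add, mul_add, hx, hy]
  | tmul x y => simp

theorem rTensor_coactQuot_comp_twist (Q : GenQuot R H) (j : H →ₗ[R] A) :
    (coactQuot A Q).rTensor H ∘ₗ twist (rightRegular R A) j =
      twist (coactRightAct A Q) j ∘ₗ (coactQuot A Q).rTensor H :=
  rTensor_comp_twist (coactQuot_rightRegular Q) j

theorem lTensor_proj_comp_twist (hj : IsCleaving j) (Q : GenQuot R H) :
    Q.proj.lTensor A ∘ₗ twist (rightRegular R A) j =
      actMap (coactRightAct A Q) j ∘ₗ (tmulProjOne A Q).rTensor H := by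
  refine TensorProduct.ext' fun a h => ?_
  rw [LinearMap.comp_apply, hj.twist_tmul, lTensor_proj_mul_coact]
  rfl

theorem rTensor_lTensor_proj_comp_cofreeCoact_comp_twist (hj : IsCleaving j) (Q : GenQuot R H) :
    (Q.proj.lTensor A).rTensor H ∘ₗ cofreeCoact A comul ∘ₗ twist (rightRegular R A) j =
      twist (coactRightAct A Q) j ∘ₗ (tmulProjOne A Q).rTensor H := by
  rw [twist, cofreeCoact_comp_coextend _ (cofreeCoact_comul_comp_comul H), ← coextend,
    rTensor_comp_coextend, ← twist, hj.lTensor_proj_comp_twist, twist, coextend_comp_rTensor]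

theorem twist_mem_cotensor_iff [Module.Flat R H] (hj : IsCleaving j) (Q : GenQuot R H)
    (t : A ⊗[R] H) :
    twist (rightRegular R A) j t ∈ cotensor A Q ↔
      t ∈ LinearMap.range ((phi A Q).val.toLinearMap.rTensor H) := by
  have coactQuot_twist := LinearMap.congr_fun (rTensor_coactQuot_comp_twist Q j) t
  have proj_twist :=
    LinearMap.congr_fun (hj.rTensor_lTensor_proj_comp_cofreeCoact_comp_twist Q) t
  simp only [LinearMap.comp_apply] at coactQuot_twist proj_twist
  rw [mem_cotensor_iff, coactQuot_twist, proj_twist,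
    (twist_bijective _ hj.isUnit).injective.eq_iff, ← sub_eq_zero]
  have := Module.Flat.rTensor_exact H (exact_phi_val A Q) t
  rwa [LinearMap.rTensor_sub] at this

theorem exists_actMap_rTensor_coinvariants_eq [Module.Flat R H] (hj : IsCleaving j) (a : A) :
    ∃ t, actMap (rightRegular R A) j
      ((coinvariants R H A).val.toLinearMap.rTensor H t) = a := by
  obtain ⟨t, ht⟩ := (twist_bijective (rightRegular R A) hj.isUnit).surjective
    (ComoduleAlgebra.coact a)
  obtain ⟨s, rfl⟩ := (hj.twist_mem_cotensor_iff ⊤ t).1 (ht ▸ coact_mem_cotensor ⊤ a)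
  refine ⟨(Subalgebra.inclusion (phi_top_le_coinvariants R H A)).toLinearMap.rTensor H s, ?_⟩
  rw [← LinearMap.rTensor_comp_apply, ← applyCounit_comp_coextend (actMap _ j)]
  exact (congrArg (applyCounit R H A) ht).trans (ComoduleAlgebra.counit a)

theorem map_twist_range_rTensor_phi [Module.Flat R H] (hj : IsCleaving j) (Q : GenQuot R H) :
    (LinearMap.range ((phi A Q).val.toLinearMap.rTensor H)).map (twist (rightRegular R A) j) =
      cotensor A Q := by
  have h := Submodule.map_comap_eq_of_surjective
    (twist_bijective (rightRegular R A) hj.isUnit).surjective (cotensor A Q)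
  rwa [show (cotensor A Q).comap (twist (rightRegular R A) j) =
    LinearMap.range ((phi A Q).val.toLinearMap.rTensor H) from
      Submodule.ext (hj.twist_mem_cotensor_iff Q)] at h

variable {S : Subalgebra R A} (hS : coinvariants R H A ≤ S)

/-- The map `S ⊗ H → S ⊗_B A`, `s ⊗ h ↦ s ⊗ j(h)`. -/
noncomputable def toBalanced (j : H →ₗ[R] A) : S ⊗[R] H →ₗ[R] BalancedTensor hS :=
  (balancedRel hS).mkQ ∘ₗ j.lTensor S

theorem can_comp_toBalanced (hj : IsCleaving j) :
    can H hS ∘ₗ toBalanced hS j =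
      twist (rightRegular R A) j ∘ₗ S.val.toLinearMap.rTensor H :=
  TensorProduct.ext' fun s h => (hj.twist_tmul (s : A) h).symm

theorem toBalanced_surjective [Module.Flat R H] (hj : IsCleaving j) :
    Function.Surjective (toBalanced hS j) := by
  have mk_tmul_mem_range (s : S) (t : coinvariants R H A ⊗[R] H) :
      (balancedRel hS).mkQ (s ⊗ₜ[R] actMap (rightRegular R A) j
        ((coinvariants R H A).val.toLinearMap.rTensor H t)) ∈
          LinearMap.range (toBalanced hS j) := by
    induction t with
    | zero => simp
    | add x y hx hy => simpa only [map_add, tmul_add] using add_mem hx hy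
    | tmul b h =>
      exact ⟨(s * Subalgebra.inclusion hS b) ⊗ₜ h,
        (Submodule.Quotient.eq _).2 (Submodule.subset_span ⟨s, b, j h, rfl⟩)⟩
  intro x
  obtain ⟨z, rfl⟩ := (balancedRel hS).mkQ_surjective x
  induction z with
  | zero => exact ⟨0, by simp⟩
  | add x y hx hy => exact map_add (balancedRel hS).mkQ x y ▸ (toBalanced hS j).range.add_mem hx hy
  | tmul s a =>
    obtain ⟨t, rfl⟩ := hj.exists_actMap_rTensor_coinvariants_eq a
    exact mk_tmul_mem_range s t

theorem can_injective [Module.Flat R H] (hj : IsCleaving j) : Function.Injective (can H hS) := by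
  refine Function.Injective.of_comp_right (g := toBalanced hS j) ?_ (hj.toBalanced_surjective hS)
  rw [← LinearMap.coe_comp, hj.can_comp_toBalanced, LinearMap.coe_comp]
  exact (twist_bijective _ hj.isUnit).injective.comp
    (Module.Flat.rTensor_preserves_injective_linearMap _ Subtype.val_injective)

theorem map_twist_range_rTensor_val [Module.Flat R H] (hj : IsCleaving j) :
    (LinearMap.range (S.val.toLinearMap.rTensor H)).map (twist (rightRegular R A) j) =
      LinearMap.range (can H hS) := by
  rw [← LinearMap.range_comp, ← hj.can_comp_toBalanced hS, LinearMap.range_comp_of_range_eq_top]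
  exact LinearMap.range_eq_top.2 (hj.toBalanced_surjective hS)

theorem phi_eq_iff_range_can_eq [Module.Flat R H] (hj : IsCleaving j) (Q : GenQuot R H) :
    phi A Q = S ↔ LinearMap.range (can H hS) = cotensor A Q := by
  calc phi A Q = S
    _ ↔ LinearMap.range ((phi A Q).val.toLinearMap.rTensor H) =
          LinearMap.range (S.val.toLinearMap.rTensor H) := range_rTensor_val_injective.eq_iff.symm
    _ ↔ LinearMap.range (can H hS) = cotensor A Q := by
        rw [← hj.map_twist_range_rTensor_phi, ← hj.map_twist_range_rTensor_val,
          (Submodule.map_injective_of_injective (twist_bijective _ hj.isUnit).injective).eq_iff,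
          eq_comm]

end IsCleaving

variable (R H A) in
/-- The comodule algebra `A` is cleft if it has a cleaving map. -/
def IsCleft : Prop := ∃ j : H →ₗ[R] A, IsCleaving j

end Cleaving

section CrossedProduct

variable {R : Type u} {H : Type v} {B : Type w} {A : Type w'} [CommRing R] [Ring H]
  [HopfAlgebra R H] [Ring B] [Algebra R B]

theorem CrossedSystem.mul_one_eq_twist (X : CrossedSystem R H B) (b : B) (g h : H) :
    X.mul b g 1 h =
      (LinearMap.mul' R H).lTensor B (twist (rightRegular R B) X.σ (b ⊗ₜ (g ⊗ₜ h))) := by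
  have twist_eq_sum (g : H) :
      (LinearMap.mul' R H).lTensor B (twist (rightRegular R B) X.σ (b ⊗ₜ (g ⊗ₜ h))) =
        ∑ j ∈ (ℛ R g).index, ∑ l ∈ (ℛ R h).index,
          (b * X.σ ((ℛ R g).left j ⊗ₜ (ℛ R h).left l)) ⊗ₜ[R]
            ((ℛ R g).right j * (ℛ R h).right l) := by
    rw [twist, coextend_tmul, TensorProduct.comul_tmul, ← (ℛ R g).eq, ← (ℛ R h).eq]
    simpa [sum_tmul, tmul_sum] using Finset.sum_comm
  calc X.mul b g 1 h
      = ∑ i ∈ (ℛ R g).index, (LinearMap.mul' R H).lTensor B (twist (rightRegular R B) X.σ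
          (b ⊗ₜ ((counit (R := R) ((ℛ R g).left i) • (ℛ R g).right i) ⊗ₜ h))) := by
        refine Finset.sum_congr rfl fun i _ => ?_
        simp only [← smul_tmul', tmul_smul, map_smul, twist_eq_sum, Finset.smul_sum, X.act_one,
          ← Algebra.commutes, ← Algebra.smul_def, smul_mul_assoc]
    _ = _ := by simp only [← map_sum, ← tmul_sum, ← sum_tmul, sum_counit_smul]

theorem isUnit_toConv_id : IsUnit (toConv (LinearMap.id : H →ₗ[R] H)) :=
  isUnit_iff_exists.2 ⟨_, LinearMap.id_mul_antipode, LinearMap.antipode_mul_id⟩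

theorem actMap_rightRegular_id (R E : Type*) [CommSemiring R] [Semiring E] [Algebra R E] :
    actMap (rightRegular R E) LinearMap.id = LinearMap.mul' R E :=
  TensorProduct.ext' fun _ _ => rfl

variable [Ring A] [Algebra R A] [ComoduleAlgebra R H A]

namespace CrossedProductIso

variable {X : CrossedSystem R H B} (e : CrossedProductIso X A)

/-- The map `h ↦ 1 # h`. -/
noncomputable def cleaving : H →ₗ[R] A :=
  e.toEquiv.toLinearMap ∘ₗ TensorProduct.mk R B H 1

theorem coact_comp_cleaving :
    (ComoduleAlgebra.coact (R := R)).toLinearMap ∘ₗ e.cleaving = e.cleaving.rTensor H ∘ₗ comul := by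
  ext h
  change ComoduleAlgebra.coact (e.toEquiv (1 ⊗ₜ h)) =
    (e.toEquiv.toLinearMap ∘ₗ TensorProduct.mk R B H 1).rTensor H (comul h)
  rw [e.map_coact, LinearMap.rTensor_comp_apply, ← cofreeCoact_tmul]
  rfl

theorem actMap_cleaving_comp_rTensor :
    actMap (rightRegular R A) e.cleaving ∘ₗ e.toEquiv.toLinearMap.rTensor H =
      e.toEquiv.toLinearMap ∘ₗ (LinearMap.mul' R H).lTensor B ∘ₗ
        twist (rightRegular R B) X.σ ∘ₗ (TensorProduct.assoc R B H H).toLinearMap :=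
  TensorProduct.ext_threefold fun b g h =>
    (e.map_mul b g 1 h).symm.trans (congrArg e.toEquiv (X.mul_one_eq_twist b g h))

theorem twist_cleaving_comp_rTensor :
    twist (rightRegular R A) e.cleaving ∘ₗ e.toEquiv.toLinearMap.rTensor H =
      e.toEquiv.toLinearMap.rTensor H ∘ₗ (TensorProduct.assoc R B H H).symm.toLinearMap ∘ₗ
        (twist (rightRegular R H) LinearMap.id).lTensor B ∘ₗ
          twist (rightRegular R B) X.σ ∘ₗ (TensorProduct.assoc R B H H).toLinearMap := by
  rw [twist, coextend_comp_rTensor, actMap_cleaving_comp_rTensor, ← rTensor_comp_coextend, twist,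
    twist, coextend_lTensor_comp_coextend_comp_assoc, actMap_rightRegular_id]

theorem twist_cleaving_bijective :
    Function.Bijective (twist (rightRegular R A) e.cleaving) := by
  have hE : Function.Bijective (e.toEquiv.toLinearMap.rTensor H) :=
    (e.toEquiv.rTensor H).bijective
  have hσ := twist_bijective (rightRegular R B) X.isUnit_σ
  have hμ : Function.Bijective ((twist (rightRegular R H) LinearMap.id).lTensor B) :=
    ((LinearEquiv.ofBijective _ (twist_bijective _ isUnit_toConv_id)).lTensor B).bijective
  rw [← Function.Bijective.of_comp_iff _ hE, ← LinearMap.coe_comp, e.twist_cleaving_comp_rTensor]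
  exact hE.comp <| (TensorProduct.assoc R B H H).symm.bijective.comp <| hμ.comp <|
    hσ.comp (TensorProduct.assoc R B H H).bijective

theorem isCleaving : IsCleaving e.cleaving :=
  ⟨e.coact_comp_cleaving, isUnit_toConv_of_twist_bijective e.twist_cleaving_bijective⟩

end CrossedProductIso

theorem IsCrossedProduct.isCleft (hA : IsCrossedProduct R H A) : IsCleft R H A := by
  obtain ⟨_, ⟨e⟩⟩ := hA
  exact ⟨e.cleaving, e.isCleaving⟩

end CrossedProduct

end HopfGalois

theorem mainTheorem8_general (R : Type u) (H : Type v) (A : Type w) [CommRing R]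
    [Ring H] [HopfAlgebra R H] [Ring A] [Algebra R A] [HopfGalois.ComoduleAlgebra R H A]
    [Module.Flat R H] (hA : HopfGalois.IsCleft R H A)
    (S : Subalgebra R A) (hS : HopfGalois.coinvariants R H A ≤ S) (Q : HopfGalois.GenQuot R H) :
    HopfGalois.phi A Q = S ↔
      Set.BijOn (HopfGalois.can H hS) Set.univ (HopfGalois.cotensor A Q) := by
  obtain ⟨j, hj⟩ := hA
  rw [hj.phi_eq_iff_range_can_eq hS Q, ← SetLike.coe_set_eq, LinearMap.coe_range, ← Set.image_univ]
  exact ⟨fun h => h ▸ (hj.can_injective hS).injOn.bijOn_image, Set.BijOn.image_eq⟩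

theorem mainTheorem8 (R : Type u) (H : Type v) (A : Type w) [CommRing R]
    [Ring H] [HopfAlgebra R H] [Ring A] [Algebra R A] [HopfGalois.ComoduleAlgebra R H A]
    (hA : HopfGalois.IsCrossedProduct R H A)
    (hBff : Module.FaithfullyFlat R (HopfGalois.coinvariants R H A))
    (hBml : HopfGalois.IsMittagLeffler R (HopfGalois.coinvariants R H A))
    (hH : Module.Flat R H)
    (S : Subalgebra R A) (hS : HopfGalois.coinvariants R H A ≤ S) :
    HopfGalois.IsClosedSubalgebra H S ↔
      Set.BijOn (HopfGalois.can H hS) Set.univ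
        (HopfGalois.cotensor A (HopfGalois.psi S : HopfGalois.GenQuot R H)) :=
  mainTheorem8_general R H A hA.isCleft S hS (HopfGalois.psi S)
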